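/- Let $p\ge 1$ and $q\ge 0$ be integers. On $\mathbb{Z}^p\times P(\mathbb{R}^q)$ use the coordinates $\mathbf n\in\mathbb{Z}^p$ and $u^\alpha_{\mathbf J}$ ($1\le\alpha\le q$, $\mathbf J\in\mathbb{Z}^p$). For $k,l\ge 0$ let $\Omega^{k,l}$ be the space of $(k,l)$-forms, that is, of finite sums of terms $$f(\mathbf n,[\mathbf u])\,\Delta^{i_1}\wedge\cdots\wedge\Delta^{i_k}\wedge \mathrm d_{\mathrm v}u^{\alpha_1}_{\mathbf J_1}\wedge\cdots\wedge \mathrm d_{\mathrm v}u^{\alpha_l}_{\mathbf J_l},$$ where $\Delta^1,\dots,\Delta^p$ and the $\mathrm d_{\mathrm v}u^\alpha_{\mathbf J}$ are the basic one-forms and $f$ depends on $\mathbf n$ and on a finite set $[\mathbf u]$ of the coordinates $u^\alpha_{\mathbf J}$ and is, for each $\mathbf n$, smooth in $[\mathbf u]$. For $\mathbf K\in\mathbb{Z}^p$ the shift $\mathrm S_{\mathbf K}$ replaces $f(\mathbf n,(u^\alpha_{\mathbf J}))$ by $f(\mathbf n+\mathbf K,(u^\alpha_{\mathbf J+\mathbf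 K}))$ and $\mathrm d_{\mathrm v}u^\alpha_{\mathbf J}$ by $\mathrm d_{\mathrm v}u^\alpha_{\mathbf J+\mathbf K}$, and fixes each $\Delta^i$; write $\mathrm S_i=\mathrm S_{\mathbf 1_i}$. The exterior difference is $$\mathrm d_{\mathrm h}^{\vartriangle}:\Omega^{k,l}\to\Omega^{k+1,l},\qquad \sigma\mapsto\sum_{i=1}^p\Delta^i\wedge(\mathrm S_i\sigma-\sigma).$$ For $l\ge1$ the difference interior Euler operator is $$\mathcal I^{\vartriangle}:\Omega^{p,l}\to\Omega^{p,l},\qquad \mathcal I^{\vartriangle}(\sigma)=\frac1l\sum_{\alpha=1}^q\sum_{\mathbf J\in\mathbb Z^p}\mathrm d_{\mathrm v}u^\alpha_{\mathbf 0}\wedge \mathrm S_{-\mathbf J}\Bigl(\frac{\partial}{\partial u^\alpha_{\mathbf J}}\lrcorner\,\sigma\Bigr),$$ and $\mathscr F^l:=\mathcal I^{\vartriangle}(\Omega^{p,l})$. **Theorem.** For each $l\ge1$ the augmented horizontal complex $$0\to\Omega^{0,l}\xrightarrow{\mathrm d_{\mathrm h}^{\vartriangle}}\Omega^{1,l}\xrightarrow{\mathrm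 d_{\mathrm h}^{\vartriangle}}\cdots\xrightarrow{\mathrm d_{\mathrm h}^{\vartriangle}}\Omega^{p-1,l}\xrightarrow{\mathrm d_{\mathrm h}^{\vartriangle}}\Omega^{p,l}\xrightarrow{\mathcal I^{\vartriangle}}\mathscr F^l\to0$$ is exact. In particular, $\ker\mathcal I^{\vartriangle}=\mathrm d_{\mathrm h}^{\vartriangle}(\Omega^{p-1,l})$. -/

import Mathlib

open scoped ContDiff

namespace DiffBicomplex

/-- A label of one of the coordinates `u^α_J` of the total prolongation space `P(ℝ^q)`:
the index `α` of the dependent variable, and the multi-index `J ∈ ℤ^p`. -/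
abbrev Coord (p q : ℕ) := Fin q × (Fin p → ℤ)

/-- The total prolongation space `P(ℝ^q)`; its point `u` has the coordinates `u^α_J = u (α, J)`. -/
abbrev Fibre (p q : ℕ) := Coord p q → ℝ

/-- The coordinate `u^α_{J+K}` as a function of the coordinate `u^α_J`. -/
def moveCoord {p q : ℕ} (K : Fin p → ℤ) (c : Coord p q) : Coord p q := (c.1, c.2 + K)

/-- The labels of the basic one-forms: `Sum.inl i` stands for `Δ^i`, and `Sum.inr (α, J)` for
`d_v u^α_J`. -/
abbrev Gen (p q : ℕ) := Fin p ⊕ Coord p q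

/-- The exterior algebra on the basic one-forms `Δ^i` and `d_v u^α_J`, in which every form takes
its values. -/
abbrev Ext (p q : ℕ) := ExteriorAlgebra ℝ (Gen p q →₀ ℝ)

/-- The vector `Δ^i` of the space of one-forms at a point. -/
noncomputable def deltaVec {p : ℕ} (q : ℕ) (i : Fin p) : Gen p q →₀ ℝ :=
  Finsupp.single (Sum.inl i) 1

/-- The vector `d_v u^α_J`, `c = (α, J)`, of the space of one-forms at a point. -/
noncomputable def duVec {p q : ℕ} (c : Coord p q) : Gen p q →₀ ℝ :=
  Finsupp.single (Sum.inr c) 1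

/-- Arbitrary exterior-algebra-valued functions on `ℤ^p × P(ℝ^q)`: the value of `σ` at the point
`(n, u)` is `σ n u`. The spaces `Ω^{k,l}` are subspaces of this space. -/
abbrev Form (p q : ℕ) := (Fin p → ℤ) → Fibre p q → Ext p q

/-- The coefficient functions `f(n, [u])`: they depend on `n` and on a finite subset `[u]` of the
coordinates `u^α_J`, and for each `n` they are smooth in `[u]`. -/
def IsCoeff {p q : ℕ} (f : (Fin p → ℤ) → Fibre p q → ℝ) : Prop :=
  ∃ s : Finset (Coord p q), ∀ n, ∃ g : (s → ℝ) → ℝ, ContDiff ℝ ∞ g ∧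
    ∀ u : Fibre p q, f n u = g (fun c => u c)

/-- The monomial `Δ^{i_1} ∧ ⋯ ∧ Δ^{i_k} ∧ d_v u^{α_1}_{J_1} ∧ ⋯ ∧ d_v u^{α_l}_{J_l}`, where
`c b = (α_b, J_b)`. -/
noncomputable def mono {p q k l : ℕ} (i : Fin k → Fin p) (c : Fin l → Coord p q) : Ext p q :=
  ExteriorAlgebra.ιMulti ℝ k (fun a => deltaVec q (i a)) *
    ExteriorAlgebra.ιMulti ℝ l (fun b => duVec (c b))

/-- The space `Ω^{k,l}` of `(k,l)`-forms on `ℤ^p × P(ℝ^q)`: the finite sums of terms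
`f(n,[u]) Δ^{i_1} ∧ ⋯ ∧ Δ^{i_k} ∧ d_v u^{α_1}_{J_1} ∧ ⋯ ∧ d_v u^{α_l}_{J_l}`. -/
noncomputable def Omega (p q k l : ℕ) : Submodule ℝ (Form p q) :=
  Submodule.span ℝ {σ | ∃ (f : (Fin p → ℤ) → Fibre p q → ℝ) (i : Fin k → Fin p)
    (c : Fin l → Coord p q), IsCoeff f ∧ σ = fun n u => f n u • mono i c}

/-- The shift `S_K`: pull-back along the translation `T_K`, which takes `f(n, (u^α_J))` to
`f(n + K, (u^α_{J+K}))`, `Δ^i` to `Δ^i` and `d_v u^α_J` to `d_v u^α_{J+K}`. -/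
noncomputable def shift {p q : ℕ} (K : Fin p → ℤ) : Form p q →ₗ[ℝ] Form p q where
  toFun σ := fun n u =>
    ExteriorAlgebra.map (Finsupp.lmapDomain ℝ ℝ (Sum.map id (moveCoord K)))
      (σ (n + K) (fun c => u (moveCoord K c)))
  map_add' σ τ := by funext n u; simp
  map_smul' r σ := by funext n u; simp

/-- The wedge product `w ∧ σ` of a constant one-form `w` and a form `σ`. -/
noncomputable def wedge {p q : ℕ} (w : Gen p q →₀ ℝ) : Form p q →ₗ[ℝ] Form p q where
  toFun σ := fun n u => ExteriorAlgebra.ι ℝ w * σ n u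
  map_add' σ τ := by funext n u; simp [mul_add]
  map_smul' r σ := by funext n u; simp

/-- The interior product `∂/∂u^α_J ⌟ σ`, where `c = (α, J)`: the antiderivation that takes
`d_v u^α_J` to `1` and all other basic one-forms to `0`. -/
noncomputable def contract {p q : ℕ} (c : Coord p q) : Form p q →ₗ[ℝ] Form p q where
  toFun σ := fun n u =>
    CliffordAlgebra.contractLeft (Finsupp.lapply (R := ℝ) (M := ℝ) (Sum.inr c)) (σ n u)
  map_add' σ τ := by funext n u; simp
  map_smul' r σ := by funext n u; simp

/-- The exterior difference `σ ↦ Δ^i ∧ (S_i σ - σ)` (sum over `i`) on all forms. -/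
noncomputable def extDiff (p q : ℕ) : Form p q →ₗ[ℝ] Form p q :=
  ∑ i : Fin p, wedge (deltaVec q i) ∘ₗ (shift (Pi.single i 1) - LinearMap.id)

/-- The expression `(1/l) d_v u^α ∧ S_{-J} (∂/∂u^α_J ⌟ σ)` (sum over `α` and over all `J ∈ ℤ^p`).
For `σ ∈ Ω^{k,l}` only finitely many terms differ from zero
(`DiffBicomplex.finite_support_eulerTerm`). -/
noncomputable def eulerExpr {p q : ℕ} (l : ℕ) (σ : Form p q) : Form p q :=
  (l : ℝ)⁻¹ • ∑ α : Fin q, ∑ᶠ J : Fin p → ℤ,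
    wedge (duVec (α, 0)) (shift (-J) (contract (α, J) σ))

/-! ### Facts that turn these operators into maps between the spaces `Ω^{k,l}` -/

/-- The span of the monomials of bidegree `(k,l)`. -/
noncomputable def monoSpan (p q k l : ℕ) : Submodule ℝ (Ext p q) :=
  Submodule.span ℝ {e | ∃ (i : Fin k → Fin p) (c : Fin l → Coord p q), e = mono i c}

lemma mono_mem {p q k l : ℕ} (i : Fin k → Fin p) (c : Fin l → Coord p q) :
    mono i c ∈ monoSpan p q k l :=
  Submodule.subset_span ⟨i, c, rfl⟩

lemma smul_mem_Omega {p q k l : ℕ} {f : (Fin p → ℤ) → Fibre p q → ℝ} (hf : IsCoeff f)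
    {e : Ext p q} (he : e ∈ monoSpan p q k l) :
    (fun n u => f n u • e : Form p q) ∈ Omega p q k l := by
  induction he using Submodule.span_induction with
  | mem x hx =>
    obtain ⟨i, c, rfl⟩ := hx
    exact Submodule.subset_span ⟨f, i, c, hf, rfl⟩
  | zero => convert (Omega p q k l).zero_mem using 1; funext n u; simp
  | add x y _ _ hx hy => convert (Omega p q k l).add_mem hx hy using 1; funext n u; simp
  | smul r x _ hx =>
    convert (Omega p q k l).smul_mem r hx using 1
    funext n u
    exact smul_comm (f n u) r x

lemma IsCoeff.shift {p q : ℕ} {f : (Fin p → ℤ) → Fibre p q → ℝ} (hf : IsCoeff f)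
    (K : Fin p → ℤ) : IsCoeff (fun n u => f (n + K) (fun c => u (moveCoord K c))) := by
  classical
  obtain ⟨s, hs⟩ := hf
  refine ⟨s.image (moveCoord K), fun n => ?_⟩
  obtain ⟨g, hg, hgu⟩ := hs (n + K)
  refine ⟨fun v => g (fun c => v ⟨moveCoord K c, Finset.mem_image_of_mem _ c.2⟩), ?_, ?_⟩
  · exact hg.comp (contDiff_pi.2 fun c => contDiff_apply _ _ _)
  · intro u
    exact hgu _

lemma map_mono {p q k l : ℕ} (K : Fin p → ℤ) (i : Fin k → Fin p) (c : Fin l → Coord p q) :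
    ExteriorAlgebra.map (Finsupp.lmapDomain ℝ ℝ (Sum.map id (moveCoord K))) (mono i c)
      = mono i (fun b => moveCoord K (c b)) := by
  simp only [mono, map_mul, ExteriorAlgebra.map_apply_ιMulti]
  congr 2 <;> funext a <;> simp [deltaVec, duVec]

lemma shift_mem {p q k l : ℕ} (K : Fin p → ℤ) {σ : Form p q} (hσ : σ ∈ Omega p q k l) :
    shift K σ ∈ Omega p q k l := by
  induction hσ using Submodule.span_induction with
  | mem x hx =>
    obtain ⟨f, i, c, hf, rfl⟩ := hx
    convert smul_mem_Omega (hf.shift K) (mono_mem i (fun b => moveCoord K (c b))) using 1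
    funext n u
    simp [shift, map_mono]
  | zero => simp
  | add x y _ _ hx hy => rw [map_add]; exact Submodule.add_mem _ hx hy
  | smul r x _ hx => rw [map_smul]; exact Submodule.smul_mem _ _ hx

lemma delta_mul_mono {p q k l : ℕ} (a : Fin p) (i : Fin k → Fin p) (c : Fin l → Coord p q) :
    ExteriorAlgebra.ι ℝ (deltaVec q a) * mono i c = mono (Fin.cons a i : Fin (k + 1) → Fin p) c := by
  simp only [mono, ExteriorAlgebra.ιMulti_succ_apply, mul_assoc, Fin.cons_zero]
  rfl

lemma wedge_delta_mem {p q k l : ℕ} (a : Fin p) {σ : Form p q} (hσ : σ ∈ Omega p q k l) :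
    wedge (deltaVec q a) σ ∈ Omega p q (k + 1) l := by
  induction hσ using Submodule.span_induction with
  | mem x hx =>
    obtain ⟨f, i, c, hf, rfl⟩ := hx
    convert smul_mem_Omega hf (mono_mem (Fin.cons a i : Fin (k + 1) → Fin p) c) using 1
    funext n u
    simp [wedge, delta_mul_mono]
  | zero => simp
  | add x y _ _ hx hy => rw [map_add]; exact Submodule.add_mem _ hx hy
  | smul r x _ hx => rw [map_smul]; exact Submodule.smul_mem _ _ hx

lemma extDiff_mem {p q k l : ℕ} {σ : Form p q} (hσ : σ ∈ Omega p q k l) :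
    extDiff p q σ ∈ Omega p q (k + 1) l := by
  rw [extDiff, LinearMap.sum_apply]
  exact Submodule.sum_mem _ fun i _ =>
    wedge_delta_mem i (Submodule.sub_mem _ (shift_mem _ hσ) hσ)

lemma du_mul_mono {p q k l : ℕ} (c₀ : Coord p q) (i : Fin k → Fin p) (c : Fin l → Coord p q) :
    ExteriorAlgebra.ι ℝ (duVec c₀) * mono i c
      = (-1 : ℝ) ^ k • mono i (Fin.cons c₀ c : Fin (l + 1) → Coord p q) := by
  induction k with
  | zero =>
    simp only [mono, ExteriorAlgebra.ιMulti_zero_apply, one_mul, pow_zero, one_smul,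
      ExteriorAlgebra.ιMulti_succ_apply, Fin.cons_zero]
    rfl
  | succ k ih =>
    have h := eq_neg_of_add_eq_zero_left
      (ExteriorAlgebra.ι_add_mul_swap (R := ℝ) (duVec c₀) (deltaVec q (i 0)))
    have e : ∀ {m : ℕ} (d : Fin m → Coord p q), mono i d =
        ExteriorAlgebra.ι ℝ (deltaVec q (i 0)) * mono (fun a => i a.succ) d := by
      intro m d
      rw [delta_mul_mono]
      congr 1
      exact (Fin.cons_self_tail i).symm
    rw [e c, e, ← mul_assoc, h, neg_mul, mul_assoc, ih, mul_smul_comm, pow_succ]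
    simp

lemma wedge_du_mem {p q k l : ℕ} (c₀ : Coord p q) {σ : Form p q} (hσ : σ ∈ Omega p q k l) :
    wedge (duVec c₀) σ ∈ Omega p q k (l + 1) := by
  induction hσ using Submodule.span_induction with
  | mem x hx =>
    obtain ⟨f, i, c, hf, rfl⟩ := hx
    convert smul_mem_Omega hf (Submodule.smul_mem _ ((-1 : ℝ) ^ k)
      (mono_mem i (Fin.cons c₀ c : Fin (l + 1) → Coord p q))) using 1
    funext n u
    simp [wedge, du_mul_mono]
  | zero => simp
  | add x y _ _ hx hy => rw [map_add]; exact Submodule.add_mem _ hx hy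
  | smul r x _ hx => rw [map_smul]; exact Submodule.smul_mem _ _ hx

lemma mono_succ {p q k l : ℕ} (i : Fin (k + 1) → Fin p) (c : Fin l → Coord p q) :
    mono i c = ExteriorAlgebra.ι ℝ (deltaVec q (i 0)) * mono (fun a => i a.succ) c := by
  rw [delta_mul_mono]
  congr 1
  exact (Fin.cons_self_tail i).symm

lemma mono_zero_succ {p q l : ℕ} (i : Fin 0 → Fin p) (c : Fin (l + 1) → Coord p q) :
    mono i c = ExteriorAlgebra.ι ℝ (duVec (c 0)) * mono i (fun b => c b.succ) := by
  rw [du_mul_mono, pow_zero, one_smul]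
  congr 1
  exact (Fin.cons_self_tail c).symm

lemma contractLeft_mono_succ {p q k l : ℕ} (c₀ : Coord p q) (i : Fin (k + 1) → Fin p)
    (c : Fin l → Coord p q) :
    CliffordAlgebra.contractLeft (Finsupp.lapply (R := ℝ) (M := ℝ) (Sum.inr c₀)) (mono i c)
      = -(ExteriorAlgebra.ι ℝ (deltaVec q (i 0)) *
        CliffordAlgebra.contractLeft (Finsupp.lapply (R := ℝ) (M := ℝ) (Sum.inr c₀))
          (mono (fun a => i a.succ) c)) := by
  rw [mono_succ]
  refine (CliffordAlgebra.contractLeft_ι_mul _ _ _).trans ?_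
  simp [deltaVec, ExteriorAlgebra.ι]

lemma delta_mul_mem {p q k l : ℕ} (a : Fin p) {e : Ext p q} (he : e ∈ monoSpan p q k l) :
    ExteriorAlgebra.ι ℝ (deltaVec q a) * e ∈ monoSpan p q (k + 1) l := by
  induction he using Submodule.span_induction with
  | mem x hx => obtain ⟨i, c, rfl⟩ := hx; rw [delta_mul_mono]; exact mono_mem _ _
  | zero => simp
  | add x y _ _ hx hy => rw [mul_add]; exact Submodule.add_mem _ hx hy
  | smul r x _ hx => rw [mul_smul_comm]; exact Submodule.smul_mem _ _ hx

lemma du_mul_mem {p q k l : ℕ} (c₀ : Coord p q) {e : Ext p q} (he : e ∈ monoSpan p q k l) :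
    ExteriorAlgebra.ι ℝ (duVec c₀) * e ∈ monoSpan p q k (l + 1) := by
  induction he using Submodule.span_induction with
  | mem x hx =>
    obtain ⟨i, c, rfl⟩ := hx
    rw [du_mul_mono]
    exact Submodule.smul_mem _ _ (mono_mem _ _)
  | zero => simp
  | add x y _ _ hx hy => rw [mul_add]; exact Submodule.add_mem _ hx hy
  | smul r x _ hx => rw [mul_smul_comm]; exact Submodule.smul_mem _ _ hx

lemma contractLeft_mono_eq_zero {p q k l : ℕ} (c₀ : Coord p q) (i : Fin k → Fin p)
    (c : Fin l → Coord p q) (hc : ∀ b, c b ≠ c₀) :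
    CliffordAlgebra.contractLeft (Finsupp.lapply (R := ℝ) (M := ℝ) (Sum.inr c₀)) (mono i c)
      = 0 := by
  induction k with
  | zero =>
    induction l with
    | zero =>
      simp only [mono, ExteriorAlgebra.ιMulti_zero_apply, one_mul]
      exact CliffordAlgebra.contractLeft_one (Q := (0 : QuadraticForm ℝ (Gen p q →₀ ℝ))) _
    | succ l ih =>
      rw [mono_zero_succ]
      refine (CliffordAlgebra.contractLeft_ι_mul _ _ _).trans ?_
      rw [ih (fun b => c b.succ) fun b => hc b.succ]
      simp [duVec, hc 0]
  | succ k ih => rw [contractLeft_mono_succ, ih, mul_zero, neg_zero]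

lemma contractLeft_mono_mem {p q k l : ℕ} (c₀ : Coord p q) (i : Fin k → Fin p)
    (c : Fin (l + 1) → Coord p q) :
    CliffordAlgebra.contractLeft (Finsupp.lapply (R := ℝ) (M := ℝ) (Sum.inr c₀)) (mono i c)
      ∈ monoSpan p q k l := by
  induction k with
  | zero =>
    induction l with
    | zero =>
      rw [mono_zero_succ]
      refine (congrArg (· ∈ monoSpan p q 0 0) (CliffordAlgebra.contractLeft_ι_mul _ _ _)).mpr ?_
      rw [contractLeft_mono_eq_zero _ _ _ fun b => b.elim0, mul_zero, sub_zero]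
      exact Submodule.smul_mem _ _ (mono_mem _ _)
    | succ l ih =>
      rw [mono_zero_succ]
      refine (congrArg (· ∈ monoSpan p q 0 (l + 1))
        (CliffordAlgebra.contractLeft_ι_mul _ _ _)).mpr ?_
      exact Submodule.sub_mem _ (Submodule.smul_mem _ _ (mono_mem _ _)) (du_mul_mem _ (ih _))
  | succ k ih =>
    rw [contractLeft_mono_succ]
    exact Submodule.neg_mem _ (delta_mul_mem _ (ih _))

lemma contract_mem {p q k l : ℕ} (c₀ : Coord p q) {σ : Form p q}
    (hσ : σ ∈ Omega p q k (l + 1)) : contract c₀ σ ∈ Omega p q k l := by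
  induction hσ using Submodule.span_induction with
  | mem x hx =>
    obtain ⟨f, i, c, hf, rfl⟩ := hx
    convert smul_mem_Omega hf (contractLeft_mono_mem c₀ i c) using 1
    funext n u
    simp [contract]
  | zero => simp
  | add x y _ _ hx hy => rw [map_add]; exact Submodule.add_mem _ hx hy
  | smul r x _ hx => rw [map_smul]; exact Submodule.smul_mem _ _ hx

lemma finite_contract {p q k l : ℕ} {σ : Form p q} (hσ : σ ∈ Omega p q k l) :
    {c : Coord p q | contract c σ ≠ 0}.Finite := by
  induction hσ using Submodule.span_induction with
  | mem x hx =>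
    obtain ⟨f, i, c, hf, rfl⟩ := hx
    refine (Set.finite_range c).subset fun c₀ h => ?_
    by_contra hc
    refine h ?_
    funext n u
    simp [contract, contractLeft_mono_eq_zero c₀ i c (fun b hb => hc ⟨b, hb⟩)]
  | zero => simp
  | add x y _ _ hx hy =>
    refine (hx.union hy).subset fun c h => ?_
    by_contra hc
    simp only [Set.mem_union, Set.mem_ofPred_eq, not_or, not_not] at hc
    exact h (by rw [map_add, hc.1, hc.2, add_zero])
  | smul r x _ hx =>
    refine hx.subset fun c h hc => h ?_
    rw [map_smul, hc, smul_zero]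

lemma finite_support_eulerTerm {p q k l : ℕ} {σ : Form p q} (hσ : σ ∈ Omega p q k l)
    (α : Fin q) :
    (Function.support fun J : Fin p → ℤ =>
      wedge (duVec (α, 0)) (shift (-J) (contract (α, J) σ))).Finite := by
  have h := (finite_contract hσ).preimage
    (f := fun J : Fin p → ℤ => ((α, J) : Coord p q)) (fun J _ K _ e => by simpa using e)
  refine h.subset fun J hJ hc => hJ ?_
  change contract (α, J) σ = 0 at hc
  simp only [hc, map_zero]

lemma eulerExpr_mem {p q k l : ℕ} {σ : Form p q} (hσ : σ ∈ Omega p q k l) :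
    eulerExpr l σ ∈ Omega p q k l := by
  cases l with
  | zero => simp [eulerExpr]
  | succ l =>
    refine Submodule.smul_mem _ _ (Submodule.sum_mem _ fun α _ => ?_)
    rw [finsum_eq_sum _ (finite_support_eulerTerm hσ α)]
    exact Submodule.sum_mem _ fun J _ => wedge_du_mem _ (shift_mem _ (contract_mem _ hσ))

/-- The exterior difference `d_h^Δ : Ω^{k,l} → Ω^{k',l}`, where `k' = k + 1`. -/
noncomputable def dh (p q l : ℕ) {k k' : ℕ} (h : k + 1 = k') :
    Omega p q k l →ₗ[ℝ] Omega p q k' l :=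
  (extDiff p q).restrict fun σ hσ => by subst h; exact extDiff_mem hσ

/-- The difference interior Euler operator `I^Δ : Ω^{p,l} → Ω^{p,l}`. -/
noncomputable def interiorEuler (p q l : ℕ) : Omega p q p l →ₗ[ℝ] Omega p q p l where
  toFun σ := ⟨eulerExpr l σ.1, eulerExpr_mem σ.2⟩
  map_add' σ τ := by
    apply Subtype.ext
    simp only [eulerExpr, Submodule.coe_add, map_add]
    rw [← smul_add, ← Finset.sum_add_distrib]
    congr 1
    exact Finset.sum_congr rfl fun α _ => finsum_add_distrib
      (finite_support_eulerTerm σ.2 α) (finite_support_eulerTerm τ.2 α)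
  map_smul' r σ := by
    apply Subtype.ext
    simp only [eulerExpr, Submodule.coe_smul, map_smul, RingHom.id_apply]
    rw [smul_comm r]
    congr 1
    rw [Finset.smul_sum]
    exact Finset.sum_congr rfl fun α _ =>
      (smul_finsum' r (finite_support_eulerTerm σ.2 α)).symm

/-- The space `𝓕^l = I^Δ(Ω^{p,l})`. -/
noncomputable def SourceForms (p q l : ℕ) : Submodule ℝ (Omega p q p l) :=
  LinearMap.range (interiorEuler p q l)

/-- The difference interior Euler operator as a map `I^Δ : Ω^{p,l} → 𝓕^l`. -/
noncomputable def interiorEulerOnto (p q l : ℕ) : Omega p q p l →ₗ[ℝ] SourceForms p q l :=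
  (interiorEuler p q l).rangeRestrict

end DiffBicomplex

/-! Write `d` for the exterior difference. Contraction with the vector dual to `Δ^i` satisfies a
Cartan formula (`extDiff_contractGen_inl`): its anticommutator with `d` is `S_i - 1`. Every `S_i -
1` is thus null-homotopic, so exactness would follow if it were invertible compatibly with `d`. It
is not, but in vertical degree `l ≥ 1` the operator `1 - S_i` has a left inverse `h_i` (`shiftInv`),
built from the vertical counting identity `∑ d_v u_c ∧ (∂_c ⌟ σ) = l σ` by applying `(S_i^{-J_i} -
1)/(S_i - 1)` to the term with label `c = (α, J)`.

The operator `h_i` commutes with every `Δ^a ∧` and with `S_j` for `j ≠ i`. Hence it commutes with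
`d` up to a multiple of `Δ^i`, and a closed form is cohomologous to a multiple of `Δ^i`
(`add_extDiff_eq_wedge`). Treating the directions one by one, without losing the earlier factors,
gives a cohomologous form killed by every `Δ^i ∧`; in horizontal degree `k < p` such a form is zero
(`eq_zero_of_wedge_delta_eq_zero`).

In degree `p` every form is closed, so the Cartan formula makes `S_K σ - σ` exact for all `K`. The
Euler operator differs from the counting identity only by shifts of its terms, so it is the identity
modulo exact forms (`eulerExpr_sub_mem_map_extDiff`), and its kernel consists of exact forms.
Conversely it is shift-invariant and commutes with `Δ^i ∧`, so it kills `d` (`eulerExpr_extDiff`).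
-/

namespace DiffBicomplex

/-! ### Pointwise operators on forms -/

/-- The interior product with the vector dual to the basic one-form labelled by `g`. -/
noncomputable def contractGen {p q : ℕ} (g : Gen p q) : Form p q →ₗ[ℝ] Form p q where
  toFun σ := fun n u =>
    CliffordAlgebra.contractLeft (Finsupp.lapply (R := ℝ) (M := ℝ) g) (σ n u)
  map_add' σ τ := by funext n u; simp
  map_smul' r σ := by funext n u; simp

lemma contract_eq_contractGen {p q : ℕ} (c : Coord p q) :
    contract c = contractGen (Sum.inr c) := rfl

/-- The translation of the labels of basic one-forms. -/
abbrev moveGen {p q : ℕ} (K : Fin p → ℤ) : Gen p q → Gen p q := Sum.map id (moveCoord K)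

lemma moveCoord_injective {p q : ℕ} (K : Fin p → ℤ) :
    Function.Injective (moveCoord (q := q) K) := by
  rintro ⟨α, J⟩ ⟨β, L⟩ h
  simpa [moveCoord] using h

lemma moveGen_injective {p q : ℕ} (K : Fin p → ℤ) :
    Function.Injective (moveGen (q := q) K) :=
  Function.injective_id.sumMap (moveCoord_injective K)

/-- The translation of the coordinates as a permutation. -/
def moveEquiv {p q : ℕ} (K : Fin p → ℤ) : Coord p q ≃ Coord p q :=
  (Equiv.refl _).prodCongr (Equiv.addRight K)

lemma moveEquiv_apply {p q : ℕ} (K : Fin p → ℤ) (c : Coord p q) :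
    moveEquiv K c = moveCoord K c := rfl

lemma moveCoord_moveCoord {p q : ℕ} (K L : Fin p → ℤ) (c : Coord p q) :
    moveCoord K (moveCoord L c) = moveCoord (L + K) c := by
  simp [moveCoord, add_assoc]

/-- Both sides obey the same antiderivation rule on products `ι m * x`, so induction on the word
length suffices. With `f` a translation of labels, this lets shifts pass through interior products.
-/
lemma contractLeft_map {R M N : Type*} [CommRing R] [AddCommGroup M] [Module R M]
    [AddCommGroup N] [Module R N] (f : M →ₗ[R] N) (d : Module.Dual R N)
    (x : ExteriorAlgebra R M) :
    CliffordAlgebra.contractLeft (Q := (0 : QuadraticForm R N)) d (ExteriorAlgebra.map f x)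
      = ExteriorAlgebra.map f
        (CliffordAlgebra.contractLeft (Q := (0 : QuadraticForm R M)) (d ∘ₗ f) x) := by
  induction x using CliffordAlgebra.left_induction with
  | algebraMap r =>
    rw [CliffordAlgebra.contractLeft_algebraMap, map_zero, AlgHom.commutes]
    exact CliffordAlgebra.contractLeft_algebraMap _ d r
  | add x y hx hy => simp only [map_add, hx, hy]
  | ι_mul x m hx =>
    have h : ExteriorAlgebra.map f (CliffordAlgebra.ι 0 m) = ExteriorAlgebra.ι R (f m) :=
      ExteriorAlgebra.map_apply_ι f m
    have h1 := (map_mul (ExteriorAlgebra.map f) (CliffordAlgebra.ι 0 m) x).trans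
      (congrArg (· * ExteriorAlgebra.map f x) h)
    have h2 := (map_mul (ExteriorAlgebra.map f) (CliffordAlgebra.ι 0 m)
      (CliffordAlgebra.contractLeft (Q := (0 : QuadraticForm R M)) (d ∘ₗ f) x)).trans
      (congrArg (· * _) h)
    rw [CliffordAlgebra.contractLeft_ι_mul, map_sub, map_smul, h2, ← hx]
    exact (congrArg _ h1).trans (CliffordAlgebra.contractLeft_ι_mul d _ _)

lemma shift_shift {p q : ℕ} (K L : Fin p → ℤ) (σ : Form p q) :
    shift K (shift L σ) = shift (K + L) σ := by
  funext n u
  simp only [shift, LinearMap.coe_mk, AddHom.coe_mk, moveCoord_moveCoord, add_assoc]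
  rw [← AlgHom.comp_apply, ExteriorAlgebra.map_comp_map, ← Finsupp.lmapDomain_comp]
  have h : (Sum.map id (moveCoord K) ∘ Sum.map id (moveCoord L) : Gen p q → Gen p q)
      = Sum.map id (moveCoord (K + L)) := by
    funext g
    rcases g with i | c
    · rfl
    · simp [moveCoord_moveCoord, add_comm]
  rw [h, add_comm L K]

lemma shift_zero {p q : ℕ} (σ : Form p q) : shift 0 σ = σ := by
  funext n u
  have h : (Sum.map id (moveCoord 0) : Gen p q → Gen p q) = id := by
    funext g
    rcases g with i | c <;> simp [moveCoord]
  simp only [shift, LinearMap.coe_mk, AddHom.coe_mk, h, Finsupp.lmapDomain_id,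
    ExteriorAlgebra.map_id]
  simp [moveCoord]

lemma shift_comm {p q : ℕ} (K L : Fin p → ℤ) (σ : Form p q) :
    shift K (shift L σ) = shift L (shift K σ) := by
  rw [shift_shift, shift_shift, add_comm]

lemma shift_wedge_single {p q : ℕ} (K : Fin p → ℤ) (g : Gen p q) (σ : Form p q) :
    shift K (wedge (Finsupp.single g 1) σ)
      = wedge (Finsupp.single (moveGen K g) 1) (shift K σ) := by
  funext n u
  simp [shift, wedge]

lemma shift_wedge_delta {p q : ℕ} (K : Fin p → ℤ) (i : Fin p) (σ : Form p q) :
    shift K (wedge (deltaVec q i) σ) = wedge (deltaVec q i) (shift K σ) :=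
  shift_wedge_single K _ σ

lemma shift_wedge_du {p q : ℕ} (K : Fin p → ℤ) (c : Coord p q) (σ : Form p q) :
    shift K (wedge (duVec c) σ) = wedge (duVec (moveCoord K c)) (shift K σ) :=
  shift_wedge_single K _ σ

lemma contractGen_shift {p q : ℕ} (K : Fin p → ℤ) (g : Gen p q) (σ : Form p q) :
    contractGen (moveGen K g) (shift K σ) = shift K (contractGen g σ) := by
  funext n u
  simp only [shift, contractGen, LinearMap.coe_mk, AddHom.coe_mk]
  have h : Finsupp.lapply (moveGen K g) ∘ₗ Finsupp.lmapDomain ℝ ℝ (Sum.map id (moveCoord K))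
      = Finsupp.lapply (R := ℝ) (M := ℝ) g :=
    LinearMap.ext fun v => Finsupp.mapDomain_apply (moveGen_injective K) v g
  rw [contractLeft_map, h]

lemma contract_shift {p q : ℕ} (K : Fin p → ℤ) (c : Coord p q) (σ : Form p q) :
    contract (moveCoord K c) (shift K σ) = shift K (contract c σ) :=
  contractGen_shift K (Sum.inr c) σ

lemma contractGen_inl_shift {p q : ℕ} (K : Fin p → ℤ) (i : Fin p) (σ : Form p q) :
    contractGen (Sum.inl i) (shift K σ) = shift K (contractGen (Sum.inl i) σ) :=
  contractGen_shift K (Sum.inl i) σ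

lemma contractGen_wedge {p q : ℕ} (g : Gen p q) (w : Gen p q →₀ ℝ) (σ : Form p q) :
    contractGen g (wedge w σ) = w g • σ - wedge w (contractGen g σ) := by
  funext n u
  exact CliffordAlgebra.contractLeft_ι_mul _ _ _

lemma contract_wedge_delta {p q : ℕ} (c : Coord p q) (i : Fin p) (σ : Form p q) :
    contract c (wedge (deltaVec q i) σ) = -wedge (deltaVec q i) (contract c σ) := by
  rw [contract_eq_contractGen, contractGen_wedge]
  simp [deltaVec]

lemma contractGen_inl_wedge_delta {p q : ℕ} (i j : Fin p) (σ : Form p q) :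
    contractGen (Sum.inl i) (wedge (deltaVec q j) σ)
      = (if i = j then σ else 0) - wedge (deltaVec q j) (contractGen (Sum.inl i) σ) := by
  classical
  rw [contractGen_wedge, deltaVec, Finsupp.single_apply]
  by_cases h : i = j
  · simp [h]
  · simp [h, Ne.symm h]

lemma wedge_wedge {p q : ℕ} (v w : Gen p q →₀ ℝ) (σ : Form p q) :
    wedge v (wedge w σ) = -wedge w (wedge v σ) := by
  funext n u
  simp only [wedge, LinearMap.coe_mk, AddHom.coe_mk, Pi.neg_apply, ← mul_assoc]
  rw [eq_neg_of_add_eq_zero_left (ExteriorAlgebra.ι_add_mul_swap (R := ℝ) v w), neg_mul]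

lemma wedge_self {p q : ℕ} (v : Gen p q →₀ ℝ) (σ : Form p q) : wedge v (wedge v σ) = 0 := by
  funext n u
  simp [wedge, ← mul_assoc]

lemma extDiff_apply {p q : ℕ} (σ : Form p q) :
    extDiff p q σ = ∑ i, wedge (deltaVec q i) (shift (Pi.single i 1) σ - σ) := by
  simp [extDiff]

/-- In the double sum the `Δ^i` anticommute while the shifts commute, so the summand is
antisymmetric in the two indices. -/
lemma extDiff_extDiff {p q : ℕ} (σ : Form p q) : extDiff p q (extDiff p q σ) = 0 := by
  set T : Fin p → Fin p → Form p q := fun i j => wedge (deltaVec q i) (wedge (deltaVec q j)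
    (shift (Pi.single i 1) (shift (Pi.single j 1) σ - σ) - (shift (Pi.single j 1) σ - σ))) with hT
  have h : extDiff p q (extDiff p q σ) = ∑ i, ∑ j, T i j := by
    rw [extDiff_apply]
    refine Finset.sum_congr rfl fun i _ => ?_
    rw [extDiff_apply, map_sum, ← Finset.sum_sub_distrib, map_sum]
    refine Finset.sum_congr rfl fun j _ => ?_
    rw [shift_wedge_delta, ← map_sub]
  have hanti : ∀ i j, T i j = -T j i := fun i j => by
    simp only [hT]
    rw [wedge_wedge]
    congr 3
    simp only [map_sub, shift_comm (Pi.single i 1) (Pi.single j 1)]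
    abel
  have h2 : ∑ i, ∑ j, T i j = -∑ i, ∑ j, T i j := by
    conv_lhs => rw [Finset.sum_comm]
    simp only [← Finset.sum_neg_distrib]
    exact Finset.sum_congr rfl fun i _ => Finset.sum_congr rfl fun j _ => hanti j i
  rw [h]
  have h3 : (2 : ℝ) • ∑ i, ∑ j, T i j = 0 := by
    rw [two_smul]
    nth_rw 1 [h2]
    exact neg_add_cancel _
  exact (smul_eq_zero.1 h3).resolve_left two_ne_zero

/-- The Cartan formula for the exterior difference. -/
lemma extDiff_contractGen_inl {p q : ℕ} (i : Fin p) (σ : Form p q) :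
    extDiff p q (contractGen (Sum.inl i) σ)
      = shift (Pi.single i 1) σ - σ - contractGen (Sum.inl i) (extDiff p q σ) := by
  simp only [extDiff_apply, map_sum, contractGen_inl_wedge_delta, Finset.sum_sub_distrib,
    Finset.sum_ite_eq, Finset.mem_univ, if_true, contractGen_inl_shift, map_sub]
  abel

/-! ### Membership in the spaces of forms -/

/-- The space of forms of bidegree `(k - 1, l)`, which is zero for `k = 0`. -/
noncomputable def prevOmega (p q : ℕ) : ℕ → ℕ → Submodule ℝ (Form p q)
  | 0, _ => ⊥
  | k + 1, l => Omega p q k l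

lemma contractLeft_inl_mono_zero {p q l : ℕ} (j : Fin p) (i : Fin 0 → Fin p)
    (c : Fin l → Coord p q) :
    CliffordAlgebra.contractLeft (Finsupp.lapply (R := ℝ) (M := ℝ) (Sum.inl j)) (mono i c)
      = 0 := by
  induction l with
  | zero =>
    simp only [mono, ExteriorAlgebra.ιMulti_zero_apply, one_mul]
    exact CliffordAlgebra.contractLeft_one (Q := (0 : QuadraticForm ℝ (Gen p q →₀ ℝ))) _
  | succ l ih =>
    rw [mono_zero_succ]
    refine (CliffordAlgebra.contractLeft_ι_mul _ _ _).trans ?_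
    rw [ih]
    simp [duVec]

lemma contractLeft_inl_mono_mem {p q k l : ℕ} (j : Fin p) (i : Fin (k + 1) → Fin p)
    (c : Fin l → Coord p q) :
    CliffordAlgebra.contractLeft (Finsupp.lapply (R := ℝ) (M := ℝ) (Sum.inl j)) (mono i c)
      ∈ monoSpan p q k l := by
  induction k with
  | zero =>
    rw [mono_succ]
    refine (congrArg (· ∈ monoSpan p q 0 l) (CliffordAlgebra.contractLeft_ι_mul _ _ _)).mpr ?_
    rw [contractLeft_inl_mono_zero, mul_zero, sub_zero]
    exact Submodule.smul_mem _ _ (mono_mem _ _)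
  | succ k ih =>
    rw [mono_succ]
    refine (congrArg (· ∈ monoSpan p q (k + 1) l)
      (CliffordAlgebra.contractLeft_ι_mul _ _ _)).mpr ?_
    exact Submodule.sub_mem _ (Submodule.smul_mem _ _ (mono_mem _ _)) (delta_mul_mem _ (ih _))

lemma contractGen_inl_mem {p q k l : ℕ} (j : Fin p) {σ : Form p q} (hσ : σ ∈ Omega p q k l) :
    contractGen (Sum.inl j) σ ∈ prevOmega p q k l := by
  induction hσ using Submodule.span_induction with
  | mem x hx =>
    obtain ⟨f, i, c, hf, rfl⟩ := hx
    cases k with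
    | zero =>
      refine (Submodule.mem_bot ℝ).2 ?_
      funext n u
      simp [contractGen, contractLeft_inl_mono_zero]
    | succ k =>
      have h := smul_mem_Omega hf (contractLeft_inl_mono_mem j i c)
      refine (congrArg (· ∈ Omega p q k l) ?_).mpr h
      funext n u
      simp [contractGen]
  | zero => simp
  | add x y _ _ hx hy => rw [map_add]; exact Submodule.add_mem _ hx hy
  | smul r x _ hx => rw [map_smul]; exact Submodule.smul_mem _ _ hx

lemma extDiff_mem_of_prevOmega {p q k l : ℕ} {σ : Form p q} (hσ : σ ∈ prevOmega p q k l) :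
    extDiff p q σ ∈ Omega p q k l := by
  cases k with
  | zero => rw [(Submodule.mem_bot ℝ).1 hσ, map_zero]; exact Submodule.zero_mem _
  | succ k => exact extDiff_mem hσ

/-- Pigeonhole: `p + 1` factors chosen among `Δ^1, …, Δ^p` contain a repetition. -/
lemma wedge_delta_eq_zero {p q l : ℕ} (j : Fin p) {σ : Form p q} (hσ : σ ∈ Omega p q p l) :
    wedge (deltaVec q j) σ = 0 := by
  induction hσ using Submodule.span_induction with
  | mem x hx =>
    obtain ⟨f, i, c, hf, rfl⟩ := hx
    have h : mono (Fin.cons j i : Fin (p + 1) → Fin p) c = 0 := by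
      rw [mono, AlternatingMap.map_eq_zero_of_not_injective, zero_mul]
      intro hinj
      have := Fintype.card_le_of_injective _ (Function.Injective.of_comp (f := deltaVec q) hinj)
      simp at this
    funext n u
    simp [wedge, delta_mul_mono, h]
  | zero => simp
  | add x y _ _ hx hy => rw [map_add, hx, hy, add_zero]
  | smul r x _ hx => rw [map_smul, hx, smul_zero]

lemma extDiff_eq_zero_of_top {p q l : ℕ} {σ : Form p q} (hσ : σ ∈ Omega p q p l) :
    extDiff p q σ = 0 := by
  rw [extDiff_apply]
  exact Finset.sum_eq_zero fun i _ =>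
    wedge_delta_eq_zero i (Submodule.sub_mem _ (shift_mem _ hσ) hσ)

/-- The sum of the operators `e ∧ (e^* ⌟ ·)` over a set of labels of basic one-forms. -/
noncomputable def countGen {p q : ℕ} (s : Finset (Gen p q)) (e : Ext p q) : Ext p q :=
  ∑ g ∈ s, ExteriorAlgebra.ι ℝ (Finsupp.single g (1 : ℝ)) *
    CliffordAlgebra.contractLeft (Finsupp.lapply (R := ℝ) (M := ℝ) g) e

/-- Contraction and wedging with the same covector each give a sign on passing a one-form. The signs
cancel, so the composite is a derivation, which counts the factors with labels in `s`. -/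
lemma countGen_ι_single_mul {p q : ℕ} [DecidableEq (Gen p q)] (s : Finset (Gen p q))
    (g : Gen p q) (e : Ext p q) :
    countGen s (ExteriorAlgebra.ι ℝ (Finsupp.single g (1 : ℝ)) * e)
      = (if g ∈ s then ExteriorAlgebra.ι ℝ (Finsupp.single g (1 : ℝ)) * e else 0)
        + ExteriorAlgebra.ι ℝ (Finsupp.single g (1 : ℝ)) * countGen s e := by
  have h : ∀ a : Gen p q, ExteriorAlgebra.ι ℝ (Finsupp.single a (1 : ℝ)) *
      CliffordAlgebra.contractLeft (Finsupp.lapply (R := ℝ) (M := ℝ) a)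
        (ExteriorAlgebra.ι ℝ (Finsupp.single g (1 : ℝ)) * e)
      = (if g = a then ExteriorAlgebra.ι ℝ (Finsupp.single g (1 : ℝ)) * e else 0)
        + ExteriorAlgebra.ι ℝ (Finsupp.single g (1 : ℝ)) *
          (ExteriorAlgebra.ι ℝ (Finsupp.single a (1 : ℝ)) *
            CliffordAlgebra.contractLeft (Finsupp.lapply (R := ℝ) (M := ℝ) a) e) := by
    intro a
    have h1 : CliffordAlgebra.contractLeft (Finsupp.lapply (R := ℝ) (M := ℝ) a)
        (ExteriorAlgebra.ι ℝ (Finsupp.single g (1 : ℝ)) * e)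
        = (Finsupp.single g (1 : ℝ)) a • e - ExteriorAlgebra.ι ℝ (Finsupp.single g (1 : ℝ)) *
          CliffordAlgebra.contractLeft (Finsupp.lapply (R := ℝ) (M := ℝ) a) e :=
      CliffordAlgebra.contractLeft_ι_mul _ _ _
    have h2 := eq_neg_of_add_eq_zero_left (ExteriorAlgebra.ι_add_mul_swap (R := ℝ)
      (Finsupp.single a (1 : ℝ)) (Finsupp.single g (1 : ℝ)))
    rw [h1, mul_sub, ← mul_assoc, h2, neg_mul, sub_neg_eq_add, mul_assoc, Finsupp.single_apply]
    by_cases hg : g = a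
    · subst hg; simp
    · simp [hg]
  simp only [countGen, h, Finset.sum_add_distrib, Finset.sum_ite_eq, Finset.mul_sum]

lemma countGen_one {p q : ℕ} (s : Finset (Gen p q)) : countGen s 1 = 0 :=
  Finset.sum_eq_zero fun g _ => by
    rw [show CliffordAlgebra.contractLeft (Finsupp.lapply (R := ℝ) (M := ℝ) g) (1 : Ext p q) = 0
      from CliffordAlgebra.contractLeft_one (Q := (0 : QuadraticForm ℝ (Gen p q →₀ ℝ))) _,
      mul_zero]

lemma countGen_mono_inl {p q k l : ℕ} (i : Fin k → Fin p) (c : Fin l → Coord p q) :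
    countGen (Finset.univ.map Function.Embedding.inl) (mono i c) = (k : ℝ) • mono i c := by
  classical
  induction k with
  | zero =>
    induction l with
    | zero =>
      simp only [mono, ExteriorAlgebra.ιMulti_zero_apply, one_mul, countGen_one]
      simp
    | succ l ih =>
      rw [mono_zero_succ, duVec, countGen_ι_single_mul, ih]
      simp
  | succ k ih =>
    rw [mono_succ, deltaVec, countGen_ι_single_mul, ih]
    simp [add_smul, add_comm]

/-- The set of vertical labels is infinite, so the count runs over a finite set that contains all
labels of the monomial. -/
lemma countGen_mono_inr {p q k l : ℕ} (s : Finset (Coord p q)) (i : Fin k → Fin p)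
    (c : Fin l → Coord p q) (hc : ∀ b, c b ∈ s) :
    countGen (s.map Function.Embedding.inr) (mono i c) = (l : ℝ) • mono i c := by
  classical
  induction k with
  | zero =>
    induction l with
    | zero =>
      simp only [mono, ExteriorAlgebra.ιMulti_zero_apply, one_mul, countGen_one]
      simp
    | succ l ih =>
      rw [mono_zero_succ, duVec, countGen_ι_single_mul, ih _ fun b => hc b.succ]
      simp [add_smul, add_comm, hc 0]
  | succ k ih =>
    rw [mono_succ, deltaVec, countGen_ι_single_mul, ih]
    simp

lemma sum_wedge_contractGen_inl {p q k l : ℕ} {σ : Form p q} (hσ : σ ∈ Omega p q k l) :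
    ∑ i, wedge (deltaVec q i) (contractGen (Sum.inl i) σ) = (k : ℝ) • σ := by
  induction hσ using Submodule.span_induction with
  | mem x hx =>
    obtain ⟨f, i, c, hf, rfl⟩ := hx
    funext n u
    have h := countGen_mono_inl i c
    simp only [countGen, Finset.sum_map] at h
    simp only [Finset.sum_apply, wedge, contractGen, LinearMap.coe_mk, AddHom.coe_mk, map_smul,
      mul_smul_comm, ← Finset.smul_sum, Pi.smul_apply]
    rw [smul_comm, ← h]
    rfl
  | zero => simp
  | add x y _ _ hx hy => simp only [map_add, Finset.sum_add_distrib, hx, hy, smul_add]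
  | smul r x _ hx => simp only [map_smul, ← Finset.smul_sum, hx, smul_comm r]

/-- Being killed by `Δ^i ∧` makes `σ` a fixed point of `Δ^i ∧ (∂_i ⌟ ·)`, with `∂_i` dual to `Δ^i`.
Summed over `i`, these operators give `p σ`, but they count the horizontal degree `k ≠ p`. -/
lemma eq_zero_of_wedge_delta_eq_zero {p q k l : ℕ} (hk : k < p) {σ : Form p q}
    (hσ : σ ∈ Omega p q k l) (h : ∀ i, wedge (deltaVec q i) σ = 0) : σ = 0 := by
  have h1 : ∀ i, wedge (deltaVec q i) (contractGen (Sum.inl i) σ) = σ := fun i => by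
    have := contractGen_inl_wedge_delta i i σ
    rw [h i, map_zero, if_pos rfl] at this
    exact (sub_eq_zero.1 this.symm).symm
  have h2 := sum_wedge_contractGen_inl hσ
  simp only [h1, Finset.sum_const, Finset.card_univ, Fintype.card_fin] at h2
  rw [← Nat.cast_smul_eq_nsmul ℝ, ← sub_eq_zero, ← sub_smul] at h2
  refine (smul_eq_zero.1 h2).resolve_left (sub_ne_zero.2 ?_)
  exact_mod_cast hk.ne'

/-! ### Sums over the interior products -/

/-- The sum of `T_c (∂/∂u_c ⌟ σ)` over all coordinates `c`. -/
noncomputable def contractSum {p q : ℕ} (T : Coord p q → Form p q →ₗ[ℝ] Form p q)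
    (σ : Form p q) : Form p q :=
  ∑ᶠ c, T c (contract c σ)

lemma finite_support_contract {p q k l : ℕ} (T : Coord p q → Form p q →ₗ[ℝ] Form p q)
    {σ : Form p q} (hσ : σ ∈ Omega p q k l) :
    (Function.support fun c => T c (contract c σ)).Finite := by
  refine (finite_contract hσ).subset fun c hc h => hc ?_
  simp only [h, map_zero]

section

variable {p q k l : ℕ} {σ τ : Form p q}

lemma contractSum_zero (T : Coord p q → Form p q →ₗ[ℝ] Form p q) : contractSum T 0 = 0 := by
  simp [contractSum]

lemma contractSum_add (T : Coord p q → Form p q →ₗ[ℝ] Form p q)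
    (hσ : σ ∈ Omega p q k l) (hτ : τ ∈ Omega p q k l) :
    contractSum T (σ + τ) = contractSum T σ + contractSum T τ := by
  simp only [contractSum, map_add]
  exact finsum_add_distrib (finite_support_contract T hσ) (finite_support_contract T hτ)

lemma contractSum_sub (T : Coord p q → Form p q →ₗ[ℝ] Form p q)
    (hσ : σ ∈ Omega p q k l) (hτ : τ ∈ Omega p q k l) :
    contractSum T (σ - τ) = contractSum T σ - contractSum T τ := by
  simp only [contractSum, map_sub]
  exact finsum_sub_distrib (finite_support_contract T hσ) (finite_support_contract T hτ)

lemma contractSum_sum (T : Coord p q → Form p q →ₗ[ℝ] Form p q) {ι : Type*} (s : Finset ι)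
    (f : ι → Form p q) (hf : ∀ a ∈ s, f a ∈ Omega p q k l) :
    contractSum T (∑ a ∈ s, f a) = ∑ a ∈ s, contractSum T (f a) := by
  classical
  induction s using Finset.induction_on with
  | empty => simp [contractSum_zero]
  | insert a s ha ih =>
    rw [Finset.sum_insert ha, Finset.sum_insert ha,
      contractSum_add T (hf a (Finset.mem_insert_self a s))
        (Submodule.sum_mem _ fun b hb => hf b (Finset.mem_insert_of_mem hb)),
      ih fun b hb => hf b (Finset.mem_insert_of_mem hb)]

lemma contractSum_sub_left (T U : Coord p q → Form p q →ₗ[ℝ] Form p q)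
    (hσ : σ ∈ Omega p q k l) :
    contractSum (fun c => T c - U c) σ = contractSum T σ - contractSum U σ :=
  finsum_sub_distrib (finite_support_contract T hσ) (finite_support_contract U hσ)

lemma map_contractSum (T : Coord p q → Form p q →ₗ[ℝ] Form p q) (R : Form p q →ₗ[ℝ] Form p q)
    (hσ : σ ∈ Omega p q k l) :
    R (contractSum T σ) = contractSum (fun c => R ∘ₗ T c) σ :=
  R.toAddMonoidHom.map_finsum (finite_support_contract T hσ)

/-- Translation by `K` permutes the labels, so the sum may be reindexed along it. -/
lemma contractSum_shift (T : Coord p q → Form p q →ₗ[ℝ] Form p q) (K : Fin p → ℤ) :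
    contractSum T (shift K σ) = contractSum (fun c => T (moveCoord K c) ∘ₗ shift K) σ := by
  rw [contractSum, ← finsum_comp_equiv (moveEquiv K)]
  simp only [moveEquiv_apply, contract_shift]
  rfl

lemma contractSum_wedge_delta (T : Coord p q → Form p q →ₗ[ℝ] Form p q) (i : Fin p) :
    contractSum T (wedge (deltaVec q i) σ)
      = contractSum (fun c => -(T c ∘ₗ wedge (deltaVec q i))) σ := by
  simp [contractSum, contract_wedge_delta]

lemma contractSum_mem (T : Coord p q → Form p q →ₗ[ℝ] Form p q) (V : Submodule ℝ (Form p q))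
    (hT : ∀ c, ∀ τ ∈ Omega p q k l, T c τ ∈ V) (hσ : σ ∈ Omega p q k (l + 1)) :
    contractSum T σ ∈ V :=
  finsum_induction (· ∈ V) V.zero_mem (fun _ _ => V.add_mem) fun c => hT c _ (contract_mem c hσ)

/-- The vertical counting identity, used both for the left inverse of `1 - S_i` and for the Euler
operator. -/
lemma contractSum_wedge_du (hσ : σ ∈ Omega p q k l) :
    contractSum (fun c => wedge (duVec c)) σ = (l : ℝ) • σ := by
  classical
  induction hσ using Submodule.span_induction with
  | mem x hx =>
    obtain ⟨f, i, c, hf, rfl⟩ := hx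
    -- Only labels occurring in the monomial contribute, which reduces the infinite sum to
    -- `countGen`.
    have hs : (Function.support fun d : Coord p q => wedge (duVec d) (contract d
        (fun n u => f n u • mono i c))) ⊆ (Finset.univ.image c : Finset (Coord p q)) := by
      intro d hd
      by_contra hdc
      refine hd ?_
      funext n u
      simp [contract, wedge, contractLeft_mono_eq_zero d i c
        (fun b hb => hdc (by simpa using ⟨b, hb⟩))]
    rw [contractSum, finsum_eq_sum_of_support_subset _ hs]
    funext n u
    have h := countGen_mono_inr (Finset.univ.image c) i c
      fun b => Finset.mem_image_of_mem c (Finset.mem_univ b)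
    simp only [countGen, Finset.sum_map] at h
    simp only [Finset.sum_apply, wedge, contract, LinearMap.coe_mk, AddHom.coe_mk, map_smul,
      mul_smul_comm, ← Finset.smul_sum, Pi.smul_apply]
    rw [smul_comm, ← h]
    rfl
  | zero => simp [contractSum_zero]
  | add x y hxm hym hx hy => rw [contractSum_add _ hxm hym, hx, hy, smul_add]
  | smul r x _ hx =>
    rw [smul_comm, ← hx]
    simp only [contractSum, map_smul]
    exact (smul_finsum' r (finite_support_contract _ (by assumption))).symm

end

/-! ### The partial inverse of `S_i - 1` -/

/-- The Laurent polynomial `(S_i^{-j} - 1) / (S_i - 1)` in the shift `S_i`. -/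
noncomputable def shiftQuot {p : ℕ} (q : ℕ) (i : Fin p) (j : ℤ) : Form p q →ₗ[ℝ] Form p q :=
  ∑ m ∈ Finset.range (-j).toNat, shift (Pi.single i (m : ℤ))
    - ∑ m ∈ Finset.range j.toNat, shift (Pi.single i (-(m : ℤ) - 1))

section

variable {p q k l : ℕ} {σ τ : Form p q}

/-- With `x = S_i` this is `x (x^{-j-1} - 1)/(x - 1) = (x^{-j} - 1)/(x - 1) - 1`. The sign of `j`
decides which of the two geometric sums is empty. -/
lemma shiftQuot_add_one (i : Fin p) (j : ℤ) (σ : Form p q) :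
    shiftQuot q i (j + 1) (shift (Pi.single i 1) σ) = shiftQuot q i j σ - σ := by
  simp only [shiftQuot, LinearMap.sub_apply, LinearMap.sum_apply, shift_shift, ← Pi.single_add]
  rcases le_or_gt 0 j with hj | hj
  · obtain ⟨m, rfl⟩ := Int.eq_ofNat_of_zero_le hj
    have h1 : (-((m : ℤ) + 1)).toNat = 0 := by omega
    have h2 : (-(m : ℤ)).toNat = 0 := by omega
    have h3 : ((m : ℤ) + 1).toNat = m + 1 := by omega
    -- The peeled-off term is `S_i^{-1}`, which composed with `S_i` gives the identity.
    rw [h1, h2, h3, Int.toNat_natCast, Finset.sum_range_succ']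
    simp only [Finset.range_zero, Finset.sum_empty, zero_sub, Nat.cast_zero, neg_zero,
      Int.reduceNeg, neg_add_cancel, Pi.single_zero, shift_zero, Nat.cast_add, Nat.cast_one]
    rw [neg_add, sub_eq_add_neg]
    congr 2
    refine Finset.sum_congr rfl fun a _ => ?_
    congr 3
    ring
  -- With `j = -m - 1`, both `j` and `j + 1 = -m` fall under the sum of nonnegative powers, even for
  -- `j = -1`.
  · obtain ⟨m, rfl⟩ : ∃ m : ℕ, j = -(m : ℤ) - 1 := ⟨(-j - 1).toNat, by omega⟩
    have h1 : (-(-(m : ℤ) - 1 + 1)).toNat = m := by omega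
    have h2 : (-(m : ℤ) - 1 + 1).toNat = 0 := by omega
    have h3 : (-(-(m : ℤ) - 1)).toNat = m + 1 := by omega
    have h4 : (-(m : ℤ) - 1).toNat = 0 := by omega
    rw [h1, h2, h3, h4, Finset.sum_range_succ']
    simp [shift_zero]

lemma shiftQuot_shift (i : Fin p) (j : ℤ) (K : Fin p → ℤ) (σ : Form p q) :
    shiftQuot q i j (shift K σ) = shift K (shiftQuot q i j σ) := by
  simp only [shiftQuot, LinearMap.sub_apply, LinearMap.sum_apply, map_sub, map_sum,
    shift_comm K]

lemma shiftQuot_wedge_delta (i : Fin p) (j : ℤ) (a : Fin p) (σ : Form p q) :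
    shiftQuot q i j (wedge (deltaVec q a) σ) = wedge (deltaVec q a) (shiftQuot q i j σ) := by
  simp only [shiftQuot, LinearMap.sub_apply, LinearMap.sum_apply, map_sub, map_sum,
    shift_wedge_delta]

lemma shiftQuot_mem (i : Fin p) (j : ℤ) (hσ : σ ∈ Omega p q k l) :
    shiftQuot q i j σ ∈ Omega p q k l := by
  simp only [shiftQuot, LinearMap.sub_apply, LinearMap.sum_apply]
  exact Submodule.sub_mem _ (Submodule.sum_mem _ fun _ _ => shift_mem _ hσ)
    (Submodule.sum_mem _ fun _ _ => shift_mem _ hσ)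

/-- A partial inverse of `1 - S_i` on forms of vertical degree `l ≥ 1`. -/
noncomputable def shiftInv (l : ℕ) (i : Fin p) (σ : Form p q) : Form p q :=
  (l : ℝ)⁻¹ • contractSum (fun c => shiftQuot q i (c.2 i) ∘ₗ wedge (duVec c)) σ

lemma shiftInv_mem (i : Fin p) (hσ : σ ∈ Omega p q k (l + 1)) :
    shiftInv (l + 1) i σ ∈ Omega p q k (l + 1) :=
  Submodule.smul_mem _ _ (contractSum_mem _ _
    (fun c _ hτ => shiftQuot_mem i _ (wedge_du_mem c hτ)) hσ)

lemma shiftInv_sub (m : ℕ) (i : Fin p) (hσ : σ ∈ Omega p q k l) (hτ : τ ∈ Omega p q k l) :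
    shiftInv m i (σ - τ) = shiftInv m i σ - shiftInv m i τ := by
  rw [shiftInv, contractSum_sub _ hσ hτ, smul_sub, shiftInv, shiftInv]

/-- `Δ^a` passes one interior product and one `d_v u_c`, so the two signs cancel. -/
lemma shiftInv_wedge_delta (m : ℕ) (i a : Fin p) (hσ : σ ∈ Omega p q k l) :
    shiftInv m i (wedge (deltaVec q a) σ) = wedge (deltaVec q a) (shiftInv m i σ) := by
  rw [shiftInv, contractSum_wedge_delta, shiftInv, map_smul, map_contractSum _ _ hσ]
  congr 3
  funext c
  refine LinearMap.ext fun τ => ?_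
  simp only [LinearMap.neg_apply, LinearMap.comp_apply]
  rw [wedge_wedge, map_neg, neg_neg, shiftQuot_wedge_delta]

/-- The shift raises the `i`-th entry of each label by one. By the recursion for `shiftQuot` each
term then loses one copy of `d_v u_c ∧ (∂_c ⌟ σ)`, and these add up to `l + 1` times `σ`. -/
lemma shiftInv_shift_self (i : Fin p) (hσ : σ ∈ Omega p q k (l + 1)) :
    shiftInv (l + 1) i (shift (Pi.single i 1) σ) = shiftInv (l + 1) i σ - σ := by
  have h : contractSum (fun c => shiftQuot q i (c.2 i) ∘ₗ wedge (duVec c))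
      (shift (Pi.single i 1) σ) = contractSum (fun c =>
        shiftQuot q i (c.2 i) ∘ₗ wedge (duVec c) - wedge (duVec c)) σ := by
    rw [contractSum_shift]
    congr 1
    funext c
    refine LinearMap.ext fun τ => ?_
    simp only [LinearMap.sub_apply, LinearMap.comp_apply]
    rw [← shift_wedge_du, show (moveCoord (Pi.single i 1) c).2 i = c.2 i + 1 by simp [moveCoord],
      shiftQuot_add_one]
  rw [shiftInv, h, contractSum_sub_left _ _ hσ, contractSum_wedge_du hσ, smul_sub,
    inv_smul_smul₀ (by positivity), shiftInv]

/-- The weight depends only on the `i`-th entry of the label, which `S_j` leaves alone. -/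
lemma shiftInv_shift_of_ne (m : ℕ) {i j : Fin p} (hij : i ≠ j) (hσ : σ ∈ Omega p q k l) :
    shiftInv m i (shift (Pi.single j 1) σ) = shift (Pi.single j 1) (shiftInv m i σ) := by
  rw [shiftInv, contractSum_shift, shiftInv, map_smul, map_contractSum _ _ hσ]
  congr 3
  funext c
  refine LinearMap.ext fun τ => ?_
  simp only [LinearMap.comp_apply]
  rw [← shift_wedge_du, show (moveCoord (Pi.single j 1) c).2 i = c.2 i by simp [moveCoord, hij],
    shiftQuot_shift]

/-- The `Δ^j` terms with `j ≠ i` commute with `h_i`. In direction `i`, `h_i (S_i σ - σ) = -σ`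
replaces `(S_i - 1) h_i σ`, and the last summand records the difference. -/
lemma extDiff_shiftInv (i : Fin p) (hσ : σ ∈ Omega p q k (l + 1)) :
    extDiff p q (shiftInv (l + 1) i σ) = shiftInv (l + 1) i (extDiff p q σ)
      + wedge (deltaVec q i) (shift (Pi.single i 1) (shiftInv (l + 1) i σ)
        - shiftInv (l + 1) i σ + σ) := by
  have hmem : ∀ j, shift (Pi.single j 1) σ - σ ∈ Omega p q k (l + 1) :=
    fun j => Submodule.sub_mem _ (shift_mem _ hσ) hσ
  have h1 : shiftInv (l + 1) i (extDiff p q σ)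
      = ∑ j, wedge (deltaVec q j) (shiftInv (l + 1) i (shift (Pi.single j 1) σ - σ)) := by
    rw [extDiff_apply, shiftInv, contractSum_sum _ _ _ fun j _ => wedge_delta_mem j (hmem j),
      Finset.smul_sum]
    exact Finset.sum_congr rfl fun j _ => shiftInv_wedge_delta _ i j (hmem j)
  rw [h1, extDiff_apply, ← Finset.add_sum_erase _ _ (Finset.mem_univ i),
    ← Finset.add_sum_erase (a := i) _ (fun j => wedge (deltaVec q j)
      (shiftInv (l + 1) i (shift (Pi.single j 1) σ - σ))) (Finset.mem_univ i),
    shiftInv_sub _ _ (shift_mem _ hσ) hσ, shiftInv_shift_self i hσ]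
  have h2 : ∀ j ∈ Finset.univ.erase i,
      wedge (deltaVec q j) (shiftInv (l + 1) i (shift (Pi.single j 1) σ - σ))
        = wedge (deltaVec q j) (shift (Pi.single j 1) (shiftInv (l + 1) i σ)
          - shiftInv (l + 1) i σ) := fun j hj => by
    rw [shiftInv_sub _ _ (shift_mem _ hσ) hσ,
      shiftInv_shift_of_ne _ (Finset.ne_of_mem_erase hj).symm hσ]
  rw [Finset.sum_congr rfl h2]
  simp only [map_sub, map_add]
  abel

/-! ### Exactness below the top degree -/

/-- With `ρ = (S_i - 1) h_i σ + σ`, the Cartan formula and `d h_i σ = Δ^i ∧ ρ` leave `ρ - ∂_i ⌟ (Δ^i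
∧ ρ)`, where `∂_i` is dual to `Δ^i`; this is `Δ^i ∧ (∂_i ⌟ ρ)`. -/
lemma add_extDiff_eq_wedge (i : Fin p) (hσ : σ ∈ Omega p q k (l + 1)) (h : extDiff p q σ = 0) :
    σ + extDiff p q (contractGen (Sum.inl i) (shiftInv (l + 1) i σ))
      = wedge (deltaVec q i) (contractGen (Sum.inl i) (shift (Pi.single i 1)
        (shiftInv (l + 1) i σ) - shiftInv (l + 1) i σ + σ)) := by
  rw [extDiff_contractGen_inl, extDiff_shiftInv i hσ, h,
    show shiftInv (l + 1) i (0 : Form p q) = 0 by rw [shiftInv, contractSum_zero, smul_zero],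
    zero_add, contractGen_inl_wedge_delta, if_pos rfl]
  abel

lemma exists_cohomologous_wedge_delta_eq_zero (hσ : σ ∈ Omega p q k (l + 1))
    (h : extDiff p q σ = 0) (s : Finset (Fin p)) :
    ∃ η ∈ prevOmega p q k (l + 1), ∀ i ∈ s, wedge (deltaVec q i) (σ + extDiff p q η) = 0 := by
  classical
  induction s using Finset.induction_on with
  | empty => exact ⟨0, Submodule.zero_mem _, by simp⟩
  | insert i s _ ih =>
    obtain ⟨η, hη, hs⟩ := ih
    set τ := σ + extDiff p q η with hτ
    have hτmem : τ ∈ Omega p q k (l + 1) := Submodule.add_mem _ hσ (extDiff_mem_of_prevOmega hη)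
    have hτ0 : extDiff p q τ = 0 := by rw [hτ, map_add, h, extDiff_extDiff, add_zero]
    refine ⟨η + contractGen (Sum.inl i) (shiftInv (l + 1) i τ),
      Submodule.add_mem _ hη (contractGen_inl_mem i (shiftInv_mem i hτmem)), fun j hj => ?_⟩
    rw [map_add (extDiff p q), ← add_assoc, ← hτ, add_extDiff_eq_wedge i hτmem hτ0]
    rcases eq_or_ne j i with rfl | hji
    · exact wedge_self _ _
    -- Factors gained earlier survive: up to sign, every operator applied in the correction for `i`
    -- commutes with `Δ^j ∧` when `j ≠ i`.
    · have hj0 := hs j ((Finset.mem_insert.1 hj).resolve_left hji)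
      have h1 : wedge (deltaVec q j) (shiftInv (l + 1) i τ) = 0 := by
        rw [← shiftInv_wedge_delta _ i j hτmem, hj0, shiftInv, contractSum_zero, smul_zero]
      have h2 : ∀ ρ : Form p q, wedge (deltaVec q j) ρ = 0 →
          wedge (deltaVec q j) (contractGen (Sum.inl i) ρ) = 0 := fun ρ hρ => by
        have := contractGen_inl_wedge_delta i j ρ
        rw [hρ, map_zero, if_neg hji.symm, zero_sub] at this
        exact neg_eq_zero.1 this.symm
      rw [wedge_wedge, h2, map_zero, neg_zero]
      rw [map_add, map_sub, ← shift_wedge_delta, h1, hj0]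
      simp

lemma exists_extDiff_eq (hk : k < p) (hσ : σ ∈ Omega p q k (l + 1)) (h : extDiff p q σ = 0) :
    ∃ η ∈ prevOmega p q k (l + 1), extDiff p q η = σ := by
  obtain ⟨η, hη, hz⟩ := exists_cohomologous_wedge_delta_eq_zero hσ h Finset.univ
  have := eq_zero_of_wedge_delta_eq_zero hk
    (Submodule.add_mem _ hσ (extDiff_mem_of_prevOmega hη)) fun i => hz i (Finset.mem_univ i)
  exact ⟨-η, Submodule.neg_mem _ hη, by rw [map_neg]; exact (eq_neg_of_add_eq_zero_left this).symm⟩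

/-! ### The top degree -/

/-- For unit `K` this is the Cartan formula on closed forms. The shifts acting trivially modulo
exact forms make up a subgroup of `ℤ^p`, and the unit vectors generate it. -/
lemma shift_sub_mem_map_extDiff (K : Fin p → ℤ) (hσ : σ ∈ Omega p q p l) :
    shift K σ - σ ∈ (prevOmega p q p l).map (extDiff p q) := by
  let A : AddSubgroup (Fin p → ℤ) :=
    { carrier := {K | ∀ τ ∈ Omega p q p l,
        shift K τ - τ ∈ (prevOmega p q p l).map (extDiff p q)}
      zero_mem' := fun τ _ => by simp [shift_zero]
      add_mem' := fun {K L} hK hL τ hτ => by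
        have := Submodule.add_mem _ (hK _ (shift_mem L hτ)) (hL τ hτ)
        rwa [shift_shift, sub_add_sub_cancel] at this
      neg_mem' := fun {K} hK τ hτ => by
        -- The property of `K` is applied to `S_{-K} τ`, giving `τ - S_{-K} τ` before the sign
        -- change.
        have := Submodule.neg_mem _ (hK _ (shift_mem (-K) hτ))
        rwa [shift_shift, add_neg_cancel, shift_zero, neg_sub] at this }
  have hA : ∀ i, Pi.single i 1 ∈ A := fun i τ hτ =>
    ⟨contractGen (Sum.inl i) τ, contractGen_inl_mem i hτ, by
      rw [extDiff_contractGen_inl, extDiff_eq_zero_of_top hτ, map_zero, sub_zero]⟩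
  have hK : K ∈ A := by
    rw [← Finset.univ_sum_single K]
    refine A.sum_mem fun i _ => ?_
    have := A.zsmul_mem (hA i) (K i)
    rwa [← Pi.single_smul, smul_eq_mul, mul_one] at this
  exact hK σ hσ

/-! ### The interior Euler operator modulo exact forms. -/

lemma eulerExpr_eq_contractSum (m : ℕ) (hσ : σ ∈ Omega p q k l) :
    eulerExpr m σ = (m : ℝ)⁻¹ •
      contractSum (fun c => wedge (duVec (c.1, 0)) ∘ₗ shift (-c.2)) σ := by
  rw [eulerExpr, contractSum, finsum_curry _ (finite_support_contract _ hσ),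
    finsum_eq_sum_of_fintype]
  rfl

/-- Each term is shifted back to the label `0`, which undoes any translation: `S_{-(J+K)} S_K =
S_{-J}`. -/
lemma eulerExpr_shift (m : ℕ) (K : Fin p → ℤ) (hσ : σ ∈ Omega p q k l) :
    eulerExpr m (shift K σ) = eulerExpr m σ := by
  rw [eulerExpr_eq_contractSum m hσ, eulerExpr_eq_contractSum m (shift_mem K hσ),
    contractSum_shift]
  congr 2
  funext c
  refine LinearMap.ext fun τ => ?_
  simp [moveCoord, shift_shift]

lemma eulerExpr_wedge_delta (m : ℕ) (i : Fin p) (hσ : σ ∈ Omega p q k l) :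
    eulerExpr m (wedge (deltaVec q i) σ) = wedge (deltaVec q i) (eulerExpr m σ) := by
  rw [eulerExpr_eq_contractSum m hσ, eulerExpr_eq_contractSum m (wedge_delta_mem i hσ),
    contractSum_wedge_delta, map_smul, map_contractSum _ _ hσ]
  congr 2
  funext c
  refine LinearMap.ext fun τ => ?_
  simp only [LinearMap.neg_apply, LinearMap.comp_apply]
  rw [shift_wedge_delta, wedge_wedge, neg_neg]

/-- The factor `Δ^i` comes out of the Euler operator, and `S_i σ` and `σ` have the same image. -/
lemma eulerExpr_extDiff (m : ℕ) (hσ : σ ∈ Omega p q k l) : eulerExpr m (extDiff p q σ) = 0 := by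
  have hmem : ∀ j, shift (Pi.single j 1) σ - σ ∈ Omega p q k l :=
    fun j => Submodule.sub_mem _ (shift_mem _ hσ) hσ
  rw [eulerExpr_eq_contractSum m (extDiff_mem hσ), extDiff_apply,
    contractSum_sum _ _ _ fun j _ => wedge_delta_mem j (hmem j), Finset.smul_sum]
  refine Finset.sum_eq_zero fun j _ => ?_
  rw [← eulerExpr_eq_contractSum m (wedge_delta_mem j (hmem j)), eulerExpr_wedge_delta m j (hmem j),
    eulerExpr_eq_contractSum m (hmem j), contractSum_sub _ (shift_mem _ hσ) hσ, smul_sub,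
    ← eulerExpr_eq_contractSum m hσ, ← eulerExpr_eq_contractSum m (shift_mem _ hσ),
    eulerExpr_shift m _ hσ, sub_self, map_zero]

/-- Term by term, the Euler operator is the counting identity with `S_{-J}` applied, and in top
degree a shift changes a form by an exact one. -/
lemma eulerExpr_sub_mem_map_extDiff (hσ : σ ∈ Omega p q p (l + 1)) :
    eulerExpr (l + 1) σ - σ ∈ (prevOmega p q p (l + 1)).map (extDiff p q) := by
  have h1 : σ = ((l + 1 : ℕ) : ℝ)⁻¹ • contractSum (fun c => wedge (duVec c)) σ := by
    rw [contractSum_wedge_du hσ, inv_smul_smul₀ (by positivity)]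
  rw [eulerExpr_eq_contractSum _ hσ]
  nth_rw 2 [h1]
  rw [← smul_sub, ← contractSum_sub_left _ _ hσ]
  refine Submodule.smul_mem _ _ (contractSum_mem _ _ (fun c τ hτ => ?_) hσ)
  have h2 : wedge (duVec (c.1, 0)) (shift (-c.2) τ) = shift (-c.2) (wedge (duVec c) τ) := by
    rw [shift_wedge_du, moveCoord, add_neg_cancel]
  rw [LinearMap.sub_apply, LinearMap.comp_apply, h2]
  exact shift_sub_mem_map_extDiff _ (wedge_du_mem c hτ)

end

/-! ### Exactness of the maps between the spaces of forms. -/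

lemma ker_interiorEuler (q l : ℕ) {p k : ℕ} (hk : k + 1 = p) :
    LinearMap.ker (interiorEuler p q (l + 1)) = LinearMap.range (dh p q (l + 1) hk) := by
  subst hk
  ext σ
  constructor
  · intro h
    have h0 : eulerExpr (l + 1) σ.1 = 0 := congrArg Subtype.val (LinearMap.mem_ker.1 h)
    obtain ⟨η, hη, he⟩ := eulerExpr_sub_mem_map_extDiff σ.2
    rw [h0, zero_sub] at he
    refine ⟨-⟨η, hη⟩, Subtype.ext ?_⟩
    change extDiff (k + 1) q (-η) = σ.1
    rw [map_neg, he, neg_neg]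
  · rintro ⟨η, rfl⟩
    exact LinearMap.mem_ker.2 (Subtype.ext (eulerExpr_extDiff (l + 1) η.2))

lemma exact_dh (p q l k : ℕ) (hk : k + 1 < p) :
    Function.Exact (dh p q (l + 1) (rfl : k + 1 = k + 1))
      (dh p q (l + 1) (rfl : k + 1 + 1 = k + 1 + 1)) := by
  intro σ
  constructor
  · intro h
    obtain ⟨η, hη, he⟩ := exists_extDiff_eq hk σ.2 (congrArg Subtype.val h)
    exact ⟨⟨η, hη⟩, Subtype.ext he⟩
  · rintro ⟨η, rfl⟩
    exact Subtype.ext (extDiff_extDiff η.1)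

lemma dh_injective (p q l : ℕ) (hp : 0 < p) :
    Function.Injective (dh p q (l + 1) (zero_add 1)) := by
  refine (injective_iff_map_eq_zero _).2 fun σ h => Subtype.ext ?_
  obtain ⟨η, hη, he⟩ := exists_extDiff_eq hp σ.2 (congrArg Subtype.val h)
  -- In horizontal degree zero the only available primitive is `0`.
  rw [← he, (Submodule.mem_bot ℝ).1 hη, map_zero]
  rfl

end DiffBicomplex

theorem mainTheorem2 (p q l : ℕ) (hp : 1 ≤ p) (hl : 1 ≤ l) :
    -- exactness at `Ω^{0,l}`
    Function.Injective (DiffBicomplex.dh p q l (zero_add 1)) ∧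
    -- exactness at `Ω^{k+1,l}`, `1 ≤ k + 1 < p`
    (∀ k : ℕ, k + 1 < p →
      Function.Exact (DiffBicomplex.dh p q l (rfl : k + 1 = k + 1)) (DiffBicomplex.dh p q l (rfl : k + 1 + 1 = k + 1 + 1))) ∧
    -- exactness at `Ω^{p,l}`
    (∀ (k : ℕ) (hk : k + 1 = p),
      Function.Exact (DiffBicomplex.dh p q l hk) (DiffBicomplex.interiorEulerOnto p q l)) ∧
    -- exactness at `𝓕^l`
    Function.Surjective (DiffBicomplex.interiorEulerOnto p q l) ∧
    -- in particular
    (∀ (k : ℕ) (hk : k + 1 = p),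
      LinearMap.ker (DiffBicomplex.interiorEuler p q l) = LinearMap.range (DiffBicomplex.dh p q l hk)) := by
  obtain ⟨l, rfl⟩ := Nat.exists_eq_add_of_le' hl
  refine ⟨DiffBicomplex.dh_injective p q l hp, DiffBicomplex.exact_dh p q l, fun k hk => ?_,
    LinearMap.surjective_rangeRestrict _, fun k hk => DiffBicomplex.ker_interiorEuler q l hk⟩
  -- Restricting the codomain to the range does not change the kernel.
  exact LinearMap.exact_iff.2 ((LinearMap.ker_rangeRestrict _).trans
    (DiffBicomplex.ker_interiorEuler q l hk))
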